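/- Consider imitation learning in finite MDPs with horizon $H=1$, state set $\{1,\dots,S\}$ and action set $\{1,\dots,A\}$. The initial distribution $\rho_0$ is uniform over the $S$ states, and the cost of action $a$ in state $s$ is drawn from a distribution with mean $\bar c(s,a)$. Write $\mu(\pi)=\mathbb E_{s\sim\rho_0}\big[\sum_a \pi(a\mid s)\,\bar c(s,a)\big]$ for the expected cost of a policy $\pi$, let the expert $\pi^*$ be an optimal policy, and let $Q^*$ be its cost-to-go (for $H=1$, $Q^*(s,a)=\bar c(s,a)$). In each episode $n=1,\dots,N$ the algorithm chooses a policy $\pi_n$ as a (measurable) function of its internal randomness and of what it saw in earlier episodes; then a state $s^n\sim\rho_0$ and an action $a^n\sim\pi_n(\cdot\mid s^n)$ are drawn, and the algorithm sees $s^n$, $a^n$ and a fresh random vector $\tilde Q^n\in\mathbb R^A$, drawn from a distribution depending only on $s^n$ (and the problem), with mean $Q^*(s^n,\cdot)$. Let $R_N=\sum_{n=1}^N(\mu(\pi_n)-\mu(\pi^*))$. There is a universal constant $c>0$ such that for all integers $S,A,N$ with $S,A\ge 1$ and $N\ge S\ln A$ there is a random problem of this kind, i.e. a probability distribution on a finite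 family of such problems, all with uniform $\rho_0$ and with all costs and all entries of the estimates $\tilde Q$ in $[0,1]$ almost surely, such that every episodic imitation learning algorithm satisfies $$\mathbb E[R_N]\;\ge\; c\,\sqrt{S\,\ln(A)\,N},$$ where the expectation is over the draw of the problem (which is not revealed to the algorithm), the states, actions and estimates, and the internal randomness of the algorithm. In particular, for every algorithm there is a problem in the family on which its expected regret is at least $c\sqrt{S\ln(A)N}$. -/

import Mathlib

open MeasureTheory

noncomputable section

namespace ImitationLearning

/-- A finite-horizon MDP with states `Fin S`, actions `Fin A` and horizon `H`. Time steps are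
numbered `0, …, H - 1`; the data at steps `t ≥ H` play no role. -/
structure MDP (S A H : ℕ) where
  /-- initial distribution `ρ₀` -/
  init : stdSimplex ℝ (Fin S)
  /-- transition probabilities: `trans t s a` is the law of the next state -/
  trans : ℕ → Fin S → Fin A → stdSimplex ℝ (Fin S)
  /-- cost distributions -/
  cost : ℕ → Fin S → Fin A → ProbabilityMeasure ℝ
  cost_integrable : ∀ t s a, Integrable (fun x : ℝ => x) (cost t s a : Measure ℝ)

/-- A (time-dependent) stochastic policy: `π t s a` is the probability of action `a` in state `s`
at step `t`. -/
abbrev Policy (S A : ℕ) : Type := ℕ → Fin S → stdSimplex ℝ (Fin A)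

namespace MDP

variable {S A H : ℕ}

/-- Expected cost of action `a` in state `s` at step `t`. -/
def meanCost (M : MDP S A H) (t : ℕ) (s : Fin S) (a : Fin A) : ℝ :=
  ∫ x, x ∂(M.cost t s a : Measure ℝ)

/-- Probability that running `π` produces the trajectory `τ` of states and actions. -/
def trajProb (M : MDP S A H) (π : Policy S A) (τ : Fin H → Fin S × Fin A) : ℝ :=
  ∏ t : Fin H,
    (if (t : ℕ) = 0 then (M.init : Fin S → ℝ) (τ t).1
      else
        let p : Fin S × Fin A := τ ⟨(t : ℕ) - 1, lt_of_le_of_lt (Nat.sub_le _ _) t.isLt⟩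
        (M.trans ((t : ℕ) - 1) p.1 p.2 : Fin S → ℝ) (τ t).1)
      * (π t (τ t).1 : Fin A → ℝ) (τ t).2

/-- Expected total cost `μ(π)` of a policy. -/
def totalCost (M : MDP S A H) (π : Policy S A) : ℝ :=
  ∑ τ : Fin H → Fin S × Fin A,
    M.trajProb π τ * ∑ t : Fin H, M.meanCost t (τ t).1 (τ t).2

/-- Expected cost of taking `a` in `s` at step `t` and then following `π`, when `k` steps
(step `t` included) remain. -/
def costToGo (M : MDP S A H) (π : Policy S A) : ℕ → ℕ → Fin S → Fin A → ℝ
  | 0, _, _, _ => 0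
  | k + 1, t, s, a =>
      M.meanCost t s a +
        ∑ s' : Fin S, (M.trans t s a : Fin S → ℝ) s' *
          ∑ a' : Fin A, (π (t + 1) s' : Fin A → ℝ) a' * costToGo M π k (t + 1) s' a'

/-- The state-action value (cost-to-go) `Q_t^π(s, a)`. -/
def Q (M : MDP S A H) (π : Policy S A) (t : ℕ) (s : Fin S) (a : Fin A) : ℝ :=
  M.costToGo π (H - t) t s a

end MDP

/-- An imitation learning problem: an MDP, an optimal expert, and an oracle which, asked in state
`s` at step `t`, returns a random vector (one entry per action) whose mean is the vector
`Q*_t(s, ·)` of the expert's costs-to-go. -/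
structure Problem (S A H : ℕ) extends MDP S A H where
  expert : Policy S A
  expert_optimal : ∀ π : Policy S A, toMDP.totalCost expert ≤ toMDP.totalCost π
  oracle : ℕ → Fin S → ProbabilityMeasure (Fin A → ℝ)
  oracle_integrable : ∀ t, t < H → ∀ s a,
    Integrable (fun q : Fin A → ℝ => q a) (oracle t s : Measure (Fin A → ℝ))
  oracle_unbiased : ∀ t, t < H → ∀ s a,
    ∫ q, q a ∂(oracle t s : Measure (Fin A → ℝ)) = toMDP.Q expert t s a

/-- What the learner sees in one episode: at each step the state, the action, and the noisy
vector of costs-to-go returned by the oracle. -/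
abbrev Episode (S A H : ℕ) : Type := Fin H → Fin S × Fin A × (Fin A → ℝ)

/-- An episodic imitation learning algorithm with internal randomness `Ω`: the policy used in
episode `n` (episodes are numbered from `0`) depends measurably on the internal randomness and on
the observations of the `n` previous episodes. -/
structure Algorithm (S A H : ℕ) (Ω : Type*) [MeasurableSpace Ω] where
  policy : (n : ℕ) → Ω × (Fin n → Episode S A H) → Policy S A
  measurable_policy : ∀ n, Measurable (policy n)

namespace Problem

variable {S A H : ℕ}

/-- The costs, and the values returned by the oracle, lie in `[0, 1]` almost surely. -/
def UnitBounded (M : Problem S A H) : Prop :=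
  (∀ t, t < H → ∀ s a, ∀ᵐ x ∂(M.cost t s a : Measure ℝ), x ∈ Set.Icc (0 : ℝ) 1) ∧
  (∀ t, t < H → ∀ s, ∀ᵐ q ∂(M.oracle t s : Measure (Fin A → ℝ)),
    ∀ a, q a ∈ Set.Icc (0 : ℝ) 1)

/-- The law of the observations in one episode run with the policy `π`: a trajectory of `π`, with
independent oracle answers at the visited states. -/
def episodeLaw (M : Problem S A H) (π : Policy S A) : Measure (Episode S A H) :=
  ∑ τ : Fin H → Fin S × Fin A,
    ENNReal.ofReal (M.trajProb π τ) •
      (Measure.pi (fun t : Fin H => (M.oracle t (τ t).1 : Measure (Fin A → ℝ)))).map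
        (fun q t => ((τ t).1, (τ t).2, q t))

variable {Ω : Type*} [MeasurableSpace Ω]

/-- The joint law of the internal randomness (drawn from `ν`) and of the observations in the first
`n` episodes, when the algorithm interacts with `M`. -/
def historyLaw (M : Problem S A H) (alg : Algorithm S A H Ω) (ν : ProbabilityMeasure Ω) :
    (n : ℕ) → Measure (Ω × (Fin n → Episode S A H))
  | 0 => (ν : Measure Ω).map (fun ω => (ω, Fin.elim0))
  | n + 1 => (historyLaw M alg ν n).bind fun p =>
      (M.episodeLaw (alg.policy n p)).map
        (fun e => (p.1, (Fin.snoc p.2 e : Fin (n + 1) → Episode S A H)))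

/-- The regret `R_N = ∑_{n < N} (μ(π_n) - μ(π*))` along a history of `N` episodes. -/
def regret (M : Problem S A H) (alg : Algorithm S A H Ω) (N : ℕ)
    (p : Ω × (Fin N → Episode S A H)) : ℝ :=
  ∑ n : Fin N,
    (M.totalCost (alg.policy n (p.1, fun i : Fin n => p.2 (Fin.castLE n.isLt.le i)))
      - M.totalCost M.expert)

/-- The expected regret `E[R_N]`. -/
def expectedRegret (M : Problem S A H) (alg : Algorithm S A H Ω) (ν : ProbabilityMeasure Ω)
    (N : ℕ) : ℝ :=
  ∫ p, M.regret alg N p ∂(M.historyLaw alg ν N)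

end Problem

end ImitationLearning

end

/-! Hide one slightly cheaper action in each state. For `J : Fin S → Fin A`, all costs and all
oracle entries are independent fair coins, except that action `J s` in state `s` has mean `1/2 - ε`;
`J` is uniform. The regret is then `ε` times the expected frequency, over episodes and uniform
states, of missing `J s`.

Fix a state `s₀` and the values of `J` elsewhere, and compare the `A` possible values of `J s₀` with
one baseline having no good action at `s₀` (the value `none`). The oracle reveals the whole vector
whatever the action, so the likelihood ratio of a history is a product over episodes in which
neither action nor policy enters. A factor differs from 1 only when `s₀` is visited, which has
probability `1/S`, so the second moment is `(1 + 4ε²/S)^N ≤ K := exp(4ε²N/S)` for every algorithm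
(`lintegral_prod_likelihood_sq_le`).

Under the baseline the probabilities of the `A` actions sum to 1. Cauchy–Schwarz
(`sum_lintegral_mul_le`) therefore bounds the sum over `j` of the probability of playing `j` when
`j` is the good action by `√(A K)`, so the average success probability is at most `√(K/A)`. With `ε
= √(S ln A / N)/4` one has `K = A^(1/4)`, the success probability is at most `A^(-3/8) ≤ 5/6` for `A
≥ 2`, and the averaged regret is at least `N ε / 6 = √(S ln A N)/24`. -/

namespace MeasureTheory
open scoped ENNReal

/-! ### Densities of product and Bernoulli measures. -/

theorem Measure.pi_update_withDensity {ι : Type*} [Fintype ι] [DecidableEq ι] {α : ι → Type*}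
    [∀ i, MeasurableSpace (α i)] (μ : ∀ i, Measure (α i)) [∀ i, IsProbabilityMeasure (μ i)]
    (j : ι) {f : α j → ℝ≥0∞} (hf : Measurable f)
    [∀ i, SigmaFinite (Function.update μ j ((μ j).withDensity f) i)] :
    Measure.pi (Function.update μ j ((μ j).withDensity f)) =
      (Measure.pi μ).withDensity (fun x => f (x j)) := by
  refine (Measure.pi_eq fun s hs => ?_)
  have hS : MeasurableSet (Set.univ.pi s) := MeasurableSet.univ_pi hs
  rw [withDensity_apply _ hS, Measure.restrict_pi_pi,
    ← lintegral_map (g := fun x : ∀ i, α i => x j) hf (measurable_pi_apply j)]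
  have := Measure.pi_map_eval (μ := fun i => (μ i).restrict (s i)) j
  rw [show (fun x : ∀ i, α i => x j) = Function.eval j from rfl, this, lintegral_smul_measure,
    ← Finset.mul_prod_erase Finset.univ _ (Finset.mem_univ j)]
  simp only [Measure.restrict_apply_univ, Function.update_self, withDensity_apply _ (hs j)]
  rw [mul_comm, smul_eq_mul]
  congr 1
  refine Finset.prod_congr rfl fun i hi => ?_
  rw [Function.update_of_ne (Finset.ne_of_mem_erase hi)]

end MeasureTheory

namespace ProbabilityTheory
open _root_.unitInterval
open scoped ENNReal

/-- The density is affine in `x`, interpolating the mass ratios `1 - 2ε` at 1 and `1 + 2ε` at 0;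
only these two points matter. -/
theorem bernoulliMeasure_eq_withDensity (ε : ℝ) (p h : I)
    (hp : (p : ℝ) = 1 / 2 - ε) (hh : (h : ℝ) = 1 / 2) :
    bernoulliMeasure (1 : ℝ) 0 p = (bernoulliMeasure (1 : ℝ) 0 h).withDensity
      (fun x => ENNReal.ofReal (1 - 2 * ε * (2 * x - 1))) := by
  have key : ∀ q : I, bernoulliMeasure (1 : ℝ) 0 q =
      ENNReal.ofReal q • Measure.dirac 1 + ENNReal.ofReal (1 - q) • Measure.dirac 0 := by
    intro q
    rw [bernoulliMeasure_def]
    have h1 : ENNReal.ofReal q = (toNNReal q : ℝ≥0∞) := ENNReal.ofReal_eq_coe_nnreal q.2.1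
    have h2 : ENNReal.ofReal (1 - q) = (toNNReal (σ q) : ℝ≥0∞) :=
      ENNReal.ofReal_eq_coe_nnreal (σ q).2.1
    rw [h1, h2]
    rfl
  have hm : Measurable fun x : ℝ => ENNReal.ofReal (1 - 2 * ε * (2 * x - 1)) := by fun_prop
  ext s hs
  rw [withDensity_apply _ hs, ← lintegral_indicator hs, key, key, lintegral_add_measure,
    lintegral_smul_measure, lintegral_smul_measure,
    lintegral_dirac' _ (hm.indicator hs), lintegral_dirac' _ (hm.indicator hs)]
  have e1 : ENNReal.ofReal p =
      ENNReal.ofReal h * ENNReal.ofReal (1 - 2 * ε * (2 * (1 : ℝ) - 1)) := by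
    rw [← ENNReal.ofReal_mul (by rw [hh]; norm_num), hp, hh]
    ring_nf
  have e0 : ENNReal.ofReal (1 - p) =
      ENNReal.ofReal (1 - h) * ENNReal.ofReal (1 - 2 * ε * (2 * (0 : ℝ) - 1)) := by
    rw [← ENNReal.ofReal_mul (by rw [hh]; norm_num), hp, hh]
    ring_nf
  simp only [Measure.add_apply, Measure.smul_apply, Measure.dirac_apply' _ hs, smul_eq_mul]
  rw [e1, e0]
  by_cases i1 : (1 : ℝ) ∈ s <;> by_cases i0 : (0 : ℝ) ∈ s <;> simp [i1, i0]

/-- Under a fair coin `2x - 1` is a centred sign, so the cross term vanishes. -/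
theorem lintegral_bernoulliMeasure_ofReal_sq (ε : ℝ) (h : I) (hh : (h : ℝ) = 1 / 2) :
    ∫⁻ x, ENNReal.ofReal ((1 - 2 * ε * (2 * x - 1)) ^ 2) ∂(bernoulliMeasure (1 : ℝ) 0 h) =
      ENNReal.ofReal (1 + 4 * ε ^ 2) := by
  rw [← ofReal_integral_eq_lintegral_ofReal (integrable_bernoulliMeasure _ _ _ _)
    (ae_of_all _ fun x => sq_nonneg _), integral_bernoulliMeasure]
  simp only [hh, smul_eq_mul]
  congr 1
  ring

theorem ae_bernoulliMeasure_mem_Icc (p : I) :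
    ∀ᵐ x ∂(bernoulliMeasure (1 : ℝ) 0 p), x ∈ Set.Icc (0 : ℝ) 1 := by
  rw [ae_iff, show {x : ℝ | ¬ x ∈ Set.Icc (0 : ℝ) 1} = (Set.Icc (0 : ℝ) 1)ᶜ from rfl,
    bernoulliMeasure_apply_of_notMem_of_notMem] <;> simp [measurableSet_Icc]

end ProbabilityTheory

noncomputable section

namespace ImitationLearning

open ProbabilityTheory
open scoped ENNReal

theorem measurable_snoc {X Y : Type*} [MeasurableSpace X] [MeasurableSpace Y] {n : ℕ}
    {f : X → Fin n → Y} {g : X → Y} (hf : Measurable f) (hg : Measurable g) :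
    Measurable fun x => (Fin.snoc (f x) (g x) : Fin (n + 1) → Y) := by
  refine measurable_pi_iff.2 fun i => ?_
  refine Fin.lastCases ?_ (fun k => ?_) i
  · simpa using hg
  · simpa using show Measurable fun x => f x k from (measurable_pi_apply k).comp hf

/-! ### Horizon-one history laws and change of measure. -/

namespace Problem

variable {S A H : ℕ} {Ω : Type*} [MeasurableSpace Ω]

theorem measurable_policy_apply (t : ℕ) (s : Fin S) (a : Fin A) :
    Measurable fun π : Policy S A => (π t s : Fin A → ℝ) a := by
  have h1 : Measurable fun π : Policy S A => π t s :=
    (measurable_pi_apply s).comp (measurable_pi_apply t)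
  exact (measurable_pi_apply a).comp (measurable_subtype_coe.comp h1)

theorem measurable_trajProb (M : MDP S A H) (τ : Fin H → Fin S × Fin A) :
    Measurable fun π : Policy S A => M.trajProb π τ := by
  unfold MDP.trajProb
  refine Finset.measurable_prod _ fun t _ => ?_
  exact measurable_const.mul (measurable_policy_apply _ _ _)

theorem measurable_observation (τ : Fin H → Fin S × Fin A) :
    Measurable fun (q : Fin H → Fin A → ℝ) (t : Fin H) => ((τ t).1, (τ t).2, q t) := by
  refine measurable_pi_iff.2 fun t => ?_
  exact measurable_const.prodMk (measurable_const.prodMk (measurable_pi_apply t))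

/-- Makes the `bind` in `historyLaw` compute: without measurability of the step, integrals could not
be unfolded episode by episode. -/
theorem measurable_historyStep (M : Problem S A H) (alg : Algorithm S A H Ω) (n : ℕ) :
    Measurable fun p : Ω × (Fin n → Episode S A H) =>
      (M.episodeLaw (alg.policy n p)).map
        (fun e => (p.1, (Fin.snoc p.2 e : Fin (n + 1) → Episode S A H))) := by
  have hsnoc : Measurable fun x : (Ω × (Fin n → Episode S A H)) × Episode S A H =>
      (x.1.1, (Fin.snoc x.1.2 x.2 : Fin (n + 1) → Episode S A H)) :=
    measurable_fst.fst.prodMk (measurable_snoc measurable_fst.snd measurable_snd)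
  refine Measure.measurable_of_measurable_coe _ fun s hs => ?_
  have hmk : ∀ p : Ω × (Fin n → Episode S A H), Measurable
      (fun e => (p.1, (Fin.snoc p.2 e : Fin (n + 1) → Episode S A H))) := fun p =>
    hsnoc.comp measurable_prodMk_left
  simp_rw [Measure.map_apply (hmk _) hs, episodeLaw, Measure.finsetSum_apply, Measure.smul_apply,
    smul_eq_mul]
  refine Finset.measurable_sum _ fun τ _ => ?_
  refine ((measurable_trajProb _ τ).comp (alg.measurable_policy n)).ennreal_ofReal.mul ?_
  have hp : IsProbabilityMeasure
      ((Measure.pi (fun t : Fin H => (M.oracle t (τ t).1 : Measure (Fin A → ℝ)))).map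
        (fun q t => ((τ t).1, (τ t).2, q t))) :=
    Measure.isProbabilityMeasure_map (measurable_observation τ).aemeasurable
  exact measurable_measure_prodMk_left (hsnoc hs)

theorem lintegral_historyLaw_zero (M : Problem S A H) (alg : Algorithm S A H Ω)
    (ν : ProbabilityMeasure Ω) {f : Ω × (Fin 0 → Episode S A H) → ℝ≥0∞} (hf : Measurable f) :
    ∫⁻ p, f p ∂(M.historyLaw alg ν 0) = ∫⁻ ω, f (ω, Fin.elim0) ∂(ν : Measure Ω) := by
  rw [historyLaw, lintegral_map hf (by fun_prop)]

theorem lintegral_historyLaw_succ (M : Problem S A H) (alg : Algorithm S A H Ω)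
    (ν : ProbabilityMeasure Ω) (n : ℕ) {f : Ω × (Fin (n + 1) → Episode S A H) → ℝ≥0∞}
    (hf : Measurable f) :
    ∫⁻ p, f p ∂(M.historyLaw alg ν (n + 1)) =
      ∫⁻ p, ∫⁻ e, f (p.1, Fin.snoc p.2 e) ∂(M.episodeLaw (alg.policy n p))
        ∂(M.historyLaw alg ν n) := by
  rw [historyLaw, Measure.lintegral_bind (measurable_historyStep M alg n).aemeasurable
    hf.aemeasurable]
  refine lintegral_congr fun p => ?_
  rw [lintegral_map hf]
  exact measurable_const.prodMk (measurable_snoc measurable_const measurable_id)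

theorem trajProb_one (M : MDP S A 1) (π : Policy S A) (τ : Fin 1 → Fin S × Fin A) :
    M.trajProb π τ = (M.init : Fin S → ℝ) (τ 0).1 * (π 0 (τ 0).1 : Fin A → ℝ) (τ 0).2 := by
  simp [MDP.trajProb]

theorem sum_fin_one {X R : Type*} [Fintype X] [AddCommMonoid R] (f : (Fin 1 → X) → R) :
    ∑ τ, f τ = ∑ x, f (fun _ => x) :=
  Fintype.sum_equiv (Equiv.funUnique (Fin 1) X) _ _ fun τ => by
    congr 1
    ext i
    rw [Subsingleton.elim i 0]
    rfl

theorem totalCost_one (M : MDP S A 1) (π : Policy S A) :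
    M.totalCost π = ∑ s, (M.init : Fin S → ℝ) s *
      ∑ a, (π 0 s : Fin A → ℝ) a * M.meanCost 0 s a := by
  simp [MDP.totalCost, sum_fin_one, trajProb_one, Fintype.sum_prod_type, Finset.mul_sum, mul_assoc]

theorem lintegral_episodeLaw_one (M : Problem S A 1) (π : Policy S A)
    {g : Episode S A 1 → ℝ≥0∞} (hg : Measurable g) :
    ∫⁻ e, g e ∂(M.episodeLaw π) = ∑ s, ∑ a,
      ENNReal.ofReal ((M.init : Fin S → ℝ) s * (π 0 s : Fin A → ℝ) a) *
        ∫⁻ q, g (fun _ => (s, a, q)) ∂(M.oracle 0 s : Measure (Fin A → ℝ)) := by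
  rw [episodeLaw, sum_fin_one, lintegral_finsetSum_measure, Fintype.sum_prod_type]
  refine Finset.sum_congr rfl fun s _ => Finset.sum_congr rfl fun a _ => ?_
  rw [lintegral_smul_measure, trajProb_one, lintegral_map hg (measurable_observation _),
    smul_eq_mul]
  congr 1
  have hmp := measurePreserving_eval
    (fun t : Fin 1 => (M.oracle t s : Measure (Fin A → ℝ))) 0
  have hm : Measurable fun q : Fin A → ℝ => g (fun _ => (s, a, q)) := by
    refine hg.comp (measurable_pi_iff.2 fun t => ?_)
    exact measurable_const.prodMk (measurable_const.prodMk measurable_id)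
  have := hmp.lintegral_comp hm
  simp only [Fin.val_zero] at this
  rw [← this]
  refine lintegral_congr fun q => ?_
  congr 1
  ext t : 1
  rw [Subsingleton.elim t 0]

theorem measurable_historySnoc {n : ℕ} (p : Ω × (Fin n → Episode S A H)) :
    Measurable fun e : Episode S A H =>
      (p.1, (Fin.snoc p.2 e : Fin (n + 1) → Episode S A H)) :=
  measurable_const.prodMk (measurable_snoc measurable_const measurable_id)

theorem measurable_prod_likelihood {ℓ : Fin S → (Fin A → ℝ) → ℝ≥0∞} (hℓ : ∀ s, Measurable (ℓ s))
    (n : ℕ) : Measurable fun p : Ω × (Fin n → Episode S A 1) =>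
      ∏ i, ℓ (p.2 i 0).1 (p.2 i 0).2.2 := by
  have hℓ' : Measurable fun x : Fin S × Fin A × (Fin A → ℝ) => ℓ x.1 x.2.2 :=
    measurable_from_prod_countable_right fun s => (hℓ s).comp measurable_snd
  exact Finset.measurable_prod _ fun i _ => hℓ'.comp
    ((measurable_pi_apply 0).comp ((measurable_pi_apply i).comp measurable_snd))

/-- Weighted sum of the episode probabilities when the integrand does not depend on the action. -/
theorem sum_init_mul_policy (M : MDP S A 1) (π : Policy S A) (c : Fin S → ℝ≥0∞) :
    ∑ s, ∑ a, ENNReal.ofReal ((M.init : Fin S → ℝ) s * (π 0 s : Fin A → ℝ) a) * c s =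
      ∑ s, ENNReal.ofReal ((M.init : Fin S → ℝ) s) * c s := by
  refine Finset.sum_congr rfl fun s _ => ?_
  rw [← Finset.sum_mul, ← ENNReal.ofReal_sum_of_nonneg
    (fun a _ => mul_nonneg (stdSimplex.zero_le _ _) (stdSimplex.zero_le _ _)), ← Finset.mul_sum, stdSimplex.sum_eq_one, mul_one]

theorem isProbabilityMeasure_historyLaw (M : Problem S A 1) (alg : Algorithm S A 1 Ω)
    (ν : ProbabilityMeasure Ω) (n : ℕ) : IsProbabilityMeasure (M.historyLaw alg ν n) := by
  constructor
  rw [← lintegral_one]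
  induction n with
  | zero => rw [lintegral_historyLaw_zero _ _ _ measurable_const]; simp
  | succ n ih =>
    rw [lintegral_historyLaw_succ _ _ _ _ measurable_const]
    refine Eq.trans (lintegral_congr fun p => ?_) ih
    rw [lintegral_episodeLaw_one _ _ measurable_const]
    simp only [lintegral_one, measure_univ]
    rw [sum_init_mul_policy _ _ fun _ => 1]
    simp only [mul_one]
    rw [← ENNReal.ofReal_sum_of_nonneg fun s _ => stdSimplex.zero_le _ _, stdSimplex.sum_eq_one, ENNReal.ofReal_one]

/-- Change of measure: if the oracle of `M` has density `ℓ` with respect to that of `M₀`, the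
history of `M` has as density the product of the densities of the episodes. -/
theorem lintegral_historyLaw_eq_mul_prod (M M₀ : Problem S A 1) (hinit : M.init = M₀.init)
    {ℓ : Fin S → (Fin A → ℝ) → ℝ≥0∞} (hℓ : ∀ s, Measurable (ℓ s))
    (horacle : ∀ s, (M.oracle 0 s : Measure (Fin A → ℝ)) =
      (M₀.oracle 0 s : Measure (Fin A → ℝ)).withDensity (ℓ s))
    (alg : Algorithm S A 1 Ω) (ν : ProbabilityMeasure Ω) (n : ℕ)
    {f : Ω × (Fin n → Episode S A 1) → ℝ≥0∞} (hf : Measurable f) :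
    ∫⁻ p, f p ∂(M.historyLaw alg ν n) =
      ∫⁻ p, f p * ∏ i, ℓ (p.2 i 0).1 (p.2 i 0).2.2 ∂(M₀.historyLaw alg ν n) := by
  have hfprod : ∀ {n : ℕ} {f : Ω × (Fin n → Episode S A 1) → ℝ≥0∞}, Measurable f →
      Measurable fun p => f p * ∏ i, ℓ (p.2 i 0).1 (p.2 i 0).2.2 := fun hf =>
    hf.mul (measurable_prod_likelihood hℓ _)
  induction n with
  | zero =>
    rw [lintegral_historyLaw_zero _ _ _ hf, lintegral_historyLaw_zero _ _ _ (hfprod hf)]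
    simp
  | succ n ih =>
    -- The induction hypothesis is applied to the conditional integral over the last episode, which
    -- must first be measurable in the past.
    have hmeas : Measurable fun p : Ω × (Fin n → Episode S A 1) =>
        ∫⁻ e, f (p.1, Fin.snoc p.2 e) ∂(M.episodeLaw (alg.policy n p)) := by
      have := (Measure.measurable_lintegral hf).comp (measurable_historyStep M alg n)
      rwa [show (fun p : Ω × (Fin n → Episode S A 1) =>
          ∫⁻ e, f (p.1, Fin.snoc p.2 e) ∂(M.episodeLaw (alg.policy n p))) = _ from
        funext fun p => (lintegral_map hf (measurable_historySnoc p)).symm]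
    rw [lintegral_historyLaw_succ _ _ _ _ hf,
      lintegral_historyLaw_succ _ _ _ _ (hfprod hf), ih hmeas]
    refine lintegral_congr fun p => ?_
    have hobs : ∀ (s : Fin S) (a : Fin A), Measurable fun q : Fin A → ℝ =>
        ((fun _ => (s, a, q)) : Episode S A 1) := fun s a =>
      measurable_pi_iff.2 fun t =>
        measurable_const.prodMk (measurable_const.prodMk measurable_id)
    have hfp : Measurable fun e => f (p.1, Fin.snoc p.2 e) := hf.comp (measurable_historySnoc p)
    rw [lintegral_episodeLaw_one _ _ hfp, lintegral_episodeLaw_one _ _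
      (show Measurable fun e => f (p.1, Fin.snoc p.2 e) * ∏ i : Fin (n + 1),
          ℓ ((Fin.snoc p.2 e : Fin (n + 1) → Episode S A 1) i 0).1
            ((Fin.snoc p.2 e : Fin (n + 1) → Episode S A 1) i 0).2.2 from
        (hfprod hf).comp (measurable_historySnoc p)), Finset.sum_mul]
    refine Finset.sum_congr rfl fun s _ => ?_
    rw [Finset.sum_mul]
    refine Finset.sum_congr rfl fun a _ => ?_
    -- Given the past, both problems share the initial law and the policy; only the oracle law
    -- contributes a density.
    rw [hinit, mul_assoc, horacle, lintegral_withDensity_eq_lintegral_mul _ (hℓ s)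
      (show Measurable fun q => f (p.1, Fin.snoc p.2 fun _ => (s, a, q)) from
        hfp.comp (hobs s a))]
    congr 1
    rw [← lintegral_mul_const]
    · refine lintegral_congr fun q => ?_
      simp only [Pi.mul_apply, Fin.prod_univ_castSucc, Fin.snoc_castSucc,
        Fin.snoc_last]
      ring
    · exact (hℓ s).mul (hfp.comp (hobs s a))

/-- The mean of a product of one factor per episode is a power. -/
theorem lintegral_prod_historyLaw (M : Problem S A 1)
    {ℓ : Fin S → (Fin A → ℝ) → ℝ≥0∞} (hℓ : ∀ s, Measurable (ℓ s))
    (alg : Algorithm S A 1 Ω) (ν : ProbabilityMeasure Ω) (n : ℕ) :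
    ∫⁻ p, ∏ i, ℓ (p.2 i 0).1 (p.2 i 0).2.2 ∂(M.historyLaw alg ν n) =
      (∑ s, ENNReal.ofReal ((M.init : Fin S → ℝ) s) *
        ∫⁻ q, ℓ s q ∂(M.oracle 0 s : Measure (Fin A → ℝ))) ^ n := by
  have hprod := fun n => measurable_prod_likelihood (Ω := Ω) hℓ n
  induction n with
  | zero =>
    rw [lintegral_historyLaw_zero _ _ _ (hprod 0)]
    simp
  | succ n ih =>
    rw [lintegral_historyLaw_succ _ _ _ _ (hprod (n + 1)), pow_succ, ← ih,
      ← lintegral_mul_const _ (hprod n)]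
    refine lintegral_congr fun p => ?_
    rw [lintegral_episodeLaw_one _ _ (show Measurable fun e => ∏ i : Fin (n + 1),
          ℓ ((Fin.snoc p.2 e : Fin (n + 1) → Episode S A 1) i 0).1
            ((Fin.snoc p.2 e : Fin (n + 1) → Episode S A 1) i 0).2.2 from
        (hprod (n + 1)).comp (measurable_historySnoc p))]
    simp only [Fin.prod_univ_castSucc, Fin.snoc_castSucc, Fin.snoc_last]
    simp_rw [lintegral_const_mul _ (hℓ _)]
    -- The action probabilities sum out, so the last factor is the same for every past and every
    -- algorithm.
    rw [sum_init_mul_policy _ _ fun s => (∏ i, ℓ (p.2 i 0).1 (p.2 i 0).2.2) *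
      ∫⁻ q, ℓ s q ∂(M.oracle 0 s : Measure (Fin A → ℝ)), Finset.mul_sum]
    exact Finset.sum_congr rfl fun s _ => by ring

end Problem

open Problem

/-! ### The family of hard problems and their likelihood ratios. -/

section GapProblem

variable {S A : ℕ}

theorem meanCost_of_bernoulli (M : MDP S A 1) (s : Fin S) (a : Fin A) (p : unitInterval)
    (h : (M.cost 0 s a : Measure ℝ) = bernoulliMeasure 1 0 p) : M.meanCost 0 s a = p := by
  rw [MDP.meanCost, h, integral_bernoulliMeasure]
  simp

/-- The uniform distribution on the states. -/
def uniformState (S : ℕ) [NeZero S] : stdSimplex ℝ (Fin S) :=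
  ⟨fun _ => 1 / (S : ℝ), fun _ => by positivity, by
    simp [NeZero.ne S]⟩

/-- The MDP of horizon one with uniform initial distribution and Bernoulli costs of means `m`. -/
def bernoulliMDP [NeZero S] (m : Fin S → Fin A → unitInterval) : MDP S A 1 where
  init := uniformState S
  trans _ _ _ := uniformState S
  cost _ s a := ⟨bernoulliMeasure 1 0 (m s a), inferInstance⟩
  cost_integrable _ _ _ := integrable_bernoulliMeasure _ _ _ _

/-- The deterministic policy playing `b s` in state `s`. -/
def purePolicy (b : Fin S → Fin A) : Policy S A := fun _ s =>
  ⟨Pi.single (b s) 1, single_mem_stdSimplex ℝ (b s)⟩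

theorem exists_best_action [NeZero A] (m : Fin S → Fin A → unitInterval) :
    ∃ b : Fin S → Fin A, ∀ s a, m s (b s) ≤ m s a :=
  ⟨fun s => (Finite.exists_min (m s)).choose, fun s => (Finite.exists_min (m s)).choose_spec⟩

/-- A cheapest action in each state. -/
def bestAction [NeZero A] (m : Fin S → Fin A → unitInterval) : Fin S → Fin A :=
  (exists_best_action m).choose

theorem bestAction_le [NeZero A] (m : Fin S → Fin A → unitInterval) (s : Fin S) (a : Fin A) :
    m s (bestAction m s) ≤ m s a := (exists_best_action m).choose_spec s a

/-- Means `1 / 2` except for the action `J s` (if any) in state `s`, whose mean is `1 / 2 - ε`. -/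
def gapMean (ε : Set.Icc (0 : ℝ) (1 / 2)) (J : Fin S → Option (Fin A)) (s : Fin S) (a : Fin A) :
    unitInterval :=
  if J s = some a then ⟨1 / 2 - ε, by linarith [ε.2.2], by linarith [ε.2.1]⟩
  else ⟨1 / 2, by norm_num, by norm_num⟩

theorem coe_gapMean (ε : Set.Icc (0 : ℝ) (1 / 2)) (J : Fin S → Option (Fin A)) (s : Fin S)
    (a : Fin A) : (gapMean ε J s a : ℝ) = if J s = some a then 1 / 2 - (ε : ℝ) else 1 / 2 := by
  unfold gapMean
  split_ifs <;> rfl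

variable (ε : Set.Icc (0 : ℝ) (1 / 2))

/-- The likelihood ratio of one oracle answer, when action `j` gets an advantage in state `s₀`. -/
def likelihood (s₀ : Fin S) (j : Fin A) (s : Fin S) (q : Fin A → ℝ) : ℝ≥0∞ :=
  if s = s₀ then ENNReal.ofReal (1 - 2 * ε * (2 * q j - 1)) else 1

theorem measurable_likelihood (s₀ : Fin S) (j : Fin A) (s : Fin S) :
    Measurable (likelihood ε s₀ j s) := by
  unfold likelihood
  split_ifs
  · fun_prop
  · exact measurable_const

variable [NeZero S]

theorem totalCost_bernoulliMDP (m : Fin S → Fin A → unitInterval) (π : Policy S A) :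
    (bernoulliMDP m).totalCost π =
      ∑ s, 1 / (S : ℝ) * ∑ a, (π 0 s : Fin A → ℝ) a * (m s a : ℝ) := by
  rw [totalCost_one]
  refine Finset.sum_congr rfl fun s _ => ?_
  congr 1
  refine Finset.sum_congr rfl fun a _ => ?_
  rw [meanCost_of_bernoulli _ _ _ (m s a) rfl]

theorem totalCost_purePolicy (m : Fin S → Fin A → unitInterval) (b : Fin S → Fin A) :
    (bernoulliMDP m).totalCost (purePolicy b) = ∑ s, 1 / (S : ℝ) * (m s (b s) : ℝ) := by
  rw [totalCost_bernoulliMDP]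
  refine Finset.sum_congr rfl fun s _ => ?_
  congr 1
  rw [Finset.sum_eq_single (b s)]
  · simp [purePolicy]
  · intro a _ ha
    simp [purePolicy, ha]
  · simp

theorem totalCost_purePolicy_le (m : Fin S → Fin A → unitInterval) (b : Fin S → Fin A)
    (hb : ∀ s a, m s (b s) ≤ m s a) (π : Policy S A) :
    (bernoulliMDP m).totalCost (purePolicy b) ≤ (bernoulliMDP m).totalCost π := by
  rw [totalCost_purePolicy, totalCost_bernoulliMDP]
  refine Finset.sum_le_sum fun s _ => mul_le_mul_of_nonneg_left ?_ (by positivity)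
  calc (m s (b s) : ℝ) = ∑ a, (π 0 s : Fin A → ℝ) a * (m s (b s) : ℝ) := by
        rw [← Finset.sum_mul, stdSimplex.sum_eq_one, one_mul]
    _ ≤ _ := Finset.sum_le_sum fun a _ =>
        mul_le_mul_of_nonneg_left (hb s a) (stdSimplex.zero_le _ _)

variable [NeZero A]

/-- The problem with independent Bernoulli costs and independent Bernoulli oracle answers. -/
def bernoulliProblem (m : Fin S → Fin A → unitInterval) : Problem S A 1 where
  toMDP := bernoulliMDP m
  expert := purePolicy (bestAction m)
  expert_optimal := totalCost_purePolicy_le m _ (bestAction_le m)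
  oracle _ s := ⟨Measure.pi fun a => bernoulliMeasure 1 0 (m s a), inferInstance⟩
  oracle_integrable t ht s a :=
    MeasurePreserving.integrable_comp_of_integrable
      (measurePreserving_eval (fun a => bernoulliMeasure (1 : ℝ) 0 (m s a)) a)
      (integrable_bernoulliMeasure 1 0 (m s a) fun x => x)
  oracle_unbiased t ht s a := by
    obtain rfl : t = 0 := by omega
    have hmp := measurePreserving_eval (fun a => bernoulliMeasure (1 : ℝ) 0 (m s a)) a
    have h := integral_map (μ := Measure.pi fun a => bernoulliMeasure (1 : ℝ) 0 (m s a))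
      (f := fun x : ℝ => x) hmp.measurable.aemeasurable
      measurable_id.aestronglyMeasurable
    rw [hmp.map_eq, integral_bernoulliMeasure] at h
    simp only [Function.eval] at h
    rw [ProbabilityMeasure.coe_mk, ← h]
    simp [MDP.Q, MDP.costToGo, meanCost_of_bernoulli (bernoulliMDP m) s a (m s a) rfl]

theorem unitBounded_bernoulliProblem (m : Fin S → Fin A → unitInterval) :
    (bernoulliProblem m).UnitBounded := by
  refine ⟨fun t _ s a => ae_bernoulliMeasure_mem_Icc (m s a), fun t _ s => ?_⟩
  refine ae_all_iff.2 fun a => ?_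
  have hmp := measurePreserving_eval (fun a => bernoulliMeasure (1 : ℝ) 0 (m s a)) a
  exact hmp.quasiMeasurePreserving.ae (ae_bernoulliMeasure_mem_Icc (m s a))

/-- The problem in which action `J s` (if any) has an advantage `ε` in state `s`. -/
def gapProblem (ε : Set.Icc (0 : ℝ) (1 / 2)) (J : Fin S → Option (Fin A)) : Problem S A 1 :=
  bernoulliProblem (gapMean ε J)

theorem totalCost_sub_totalCost_expert_gapProblem (J : Fin S → Fin A) (π : Policy S A) :
    (gapProblem ε fun s => some (J s)).totalCost π -
      (gapProblem ε fun s => some (J s)).totalCost (gapProblem ε fun s => some (J s)).expert =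
      ε / S * ∑ s, (1 - (π 0 s : Fin A → ℝ) (J s)) := by
  have h1 : ∀ s, ∑ a, (π 0 s : Fin A → ℝ) a * (gapMean ε (fun s => some (J s)) s a : ℝ) =
      1 / 2 - ε * (π 0 s : Fin A → ℝ) (J s) := by
    intro s
    have : ∀ a, (π 0 s : Fin A → ℝ) a * (gapMean ε (fun s => some (J s)) s a : ℝ) =
        (π 0 s : Fin A → ℝ) a * (1 / 2) -
          if J s = a then (ε : ℝ) * (π 0 s : Fin A → ℝ) a else 0 := by
      intro a
      rw [coe_gapMean]
      simp only [Option.some.injEq]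
      split_ifs <;> ring
    simp_rw [this, Finset.sum_sub_distrib, ← Finset.sum_mul, stdSimplex.sum_eq_one]
    simp
  -- Only the minimal value is identified: for `ε = 0` the chosen minimiser need not be `J s`.
  have h2 : ∀ s, (gapMean ε (fun s => some (J s)) s
      (bestAction (gapMean ε fun s => some (J s)) s) : ℝ) = 1 / 2 - ε := by
    intro s
    refine le_antisymm ?_ ?_
    · have : (gapMean ε (fun s => some (J s)) s _ : ℝ) ≤ _ :=
        bestAction_le (gapMean ε fun s => some (J s)) s (J s)
      refine this.trans_eq ?_
      rw [coe_gapMean, if_pos rfl]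
    · rw [coe_gapMean]
      have := ε.2.1
      split_ifs <;> linarith
  change (bernoulliMDP _).totalCost π - (bernoulliMDP _).totalCost (purePolicy _) = _
  rw [totalCost_bernoulliMDP, totalCost_purePolicy, ← Finset.sum_sub_distrib, Finset.mul_sum]
  refine Finset.sum_congr rfl fun s _ => ?_
  rw [h1, h2]
  ring

/-- Passing from the baseline to good action `j` changes a single factor of a single product
measure. -/
theorem oracle_gapProblem_update (J : Fin S → Option (Fin A)) (s₀ : Fin S) (hJ : J s₀ = none)
    (j : Fin A) (s : Fin S) :
    ((gapProblem ε (Function.update J s₀ (some j))).oracle 0 s : Measure (Fin A → ℝ)) =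
      ((gapProblem ε J).oracle 0 s : Measure (Fin A → ℝ)).withDensity
        (likelihood ε s₀ j s) := by
  change (Measure.pi fun a => bernoulliMeasure 1 0 _) =
    (Measure.pi fun a => bernoulliMeasure 1 0 _).withDensity _
  by_cases hs : s = s₀
  · subst hs
    have hj : bernoulliMeasure (1 : ℝ) 0 (gapMean ε (Function.update J s (some j)) s j) =
        (bernoulliMeasure (1 : ℝ) 0 (gapMean ε J s j)).withDensity
          fun x => ENNReal.ofReal (1 - 2 * ε * (2 * x - 1)) :=
      bernoulliMeasure_eq_withDensity ε _ _ (by simp [coe_gapMean]) (by simp [coe_gapMean, hJ])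
    have hupd : (fun a => bernoulliMeasure (1 : ℝ) 0
        (gapMean ε (Function.update J s (some j)) s a)) =
        Function.update (fun a => bernoulliMeasure (1 : ℝ) 0 (gapMean ε J s a)) j
          ((bernoulliMeasure (1 : ℝ) 0 (gapMean ε J s j)).withDensity
            fun x => ENNReal.ofReal (1 - 2 * ε * (2 * x - 1))) := by
      ext1 a
      by_cases ha : a = j
      · subst ha
        rw [Function.update_self, hj]
      · rw [Function.update_of_ne ha]
        congr 1
        ext
        simp [coe_gapMean, hJ, Ne.symm ha]
    have hsf : ∀ a, SigmaFinite
        (Function.update (fun a => bernoulliMeasure (1 : ℝ) 0 (gapMean ε J s a)) j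
          ((bernoulliMeasure (1 : ℝ) 0 (gapMean ε J s j)).withDensity
            fun x => ENNReal.ofReal (1 - 2 * ε * (2 * x - 1))) a) := by
      intro a
      rw [← hupd]
      infer_instance
    rw [hupd, Measure.pi_update_withDensity _ j (by fun_prop)]
    congr 1
    ext1 q
    simp [likelihood]
  · have h1 : likelihood ε s₀ j s = 1 := by
      ext1 q
      simp [likelihood, hs]
    rw [h1, withDensity_one]
    simp [gapMean, Function.update_of_ne hs]

theorem lintegral_likelihood_sq (J : Fin S → Option (Fin A)) (s₀ : Fin S) (hJ : J s₀ = none)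
    (j : Fin A) (s : Fin S) :
    ∫⁻ q, likelihood ε s₀ j s q ^ 2 ∂((gapProblem ε J).oracle 0 s : Measure (Fin A → ℝ)) =
      if s = s₀ then ENNReal.ofReal (1 + 4 * (ε : ℝ) ^ 2) else 1 := by
  change ∫⁻ q, _ ∂(Measure.pi fun a => bernoulliMeasure 1 0 (gapMean ε J s a)) = _
  by_cases hs : s = s₀
  · subst hs
    simp only [likelihood, if_true]
    rw [← lintegral_bernoulliMeasure_ofReal_sq ε (gapMean ε J s j) (by simp [coe_gapMean, hJ])]
    have hmp := measurePreserving_eval (fun a => bernoulliMeasure (1 : ℝ) 0 (gapMean ε J s a)) j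
    rw [← hmp.map_eq, lintegral_map (by fun_prop) hmp.measurable]
    -- `ENNReal.ofReal` commutes with the square only where the density is nonnegative: on `[0, 1]`,
    -- since `ε ≤ 1/2`.
    refine lintegral_congr_ae ?_
    filter_upwards [hmp.quasiMeasurePreserving.ae (ae_bernoulliMeasure_mem_Icc _)] with q hq
    simp only [Function.eval] at hq ⊢
    rw [ENNReal.ofReal_pow]
    have h0 := ε.2.1
    have h1 := ε.2.2
    nlinarith [hq.1, hq.2, mul_nonneg h0 (sub_nonneg.2 hq.2)]
  · simp [likelihood, hs]

variable {Ω : Type*} [MeasurableSpace Ω]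

theorem lintegral_prod_likelihood_sq_le (J : Fin S → Option (Fin A)) (s₀ : Fin S)
    (hJ : J s₀ = none) (j : Fin A) (alg : Algorithm S A 1 Ω) (ν : ProbabilityMeasure Ω) (n : ℕ) :
    ∫⁻ p, (∏ i, likelihood ε s₀ j (p.2 i 0).1 (p.2 i 0).2.2) ^ 2
        ∂((gapProblem ε J).historyLaw alg ν n) ≤
      ENNReal.ofReal (Real.exp (4 * (ε : ℝ) ^ 2 * n / S)) := by
  simp_rw [← Finset.prod_pow]
  have hS : (0 : ℝ) < S := by exact_mod_cast NeZero.pos S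
  rw [lintegral_prod_historyLaw _ (ℓ := fun s q => likelihood ε s₀ j s q ^ 2)
    (fun s => (measurable_likelihood ε s₀ j s).pow_const 2)]
  have hsum : ∑ s, ENNReal.ofReal (((gapProblem ε J).init : Fin S → ℝ) s) *
      ∫⁻ q, likelihood ε s₀ j s q ^ 2 ∂((gapProblem ε J).oracle 0 s : Measure (Fin A → ℝ)) =
      ENNReal.ofReal (1 + 4 * (ε : ℝ) ^ 2 / S) := by
    have : ∀ s, ENNReal.ofReal (((gapProblem ε J).init : Fin S → ℝ) s) *
        ∫⁻ q, likelihood ε s₀ j s q ^ 2 ∂((gapProblem ε J).oracle 0 s : Measure (Fin A → ℝ)) =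
        ENNReal.ofReal (1 / S + if s = s₀ then 4 * (ε : ℝ) ^ 2 / S else 0) := by
      intro s
      rw [lintegral_likelihood_sq ε J s₀ hJ, show ((gapProblem ε J).init : Fin S → ℝ) s = 1 / S
        from rfl]
      split_ifs
      · rw [← ENNReal.ofReal_mul (by positivity)]
        congr 1
        ring
      · simp
    simp_rw [this]
    rw [← ENNReal.ofReal_sum_of_nonneg fun s _ => by positivity, Finset.sum_add_distrib]
    simp [hS.ne']
  rw [hsum, ← ENNReal.ofReal_pow (by positivity)]
  refine ENNReal.ofReal_le_ofReal ?_
  calc (1 + 4 * (ε : ℝ) ^ 2 / S) ^ n ≤ Real.exp (4 * (ε : ℝ) ^ 2 / S) ^ n := by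
        gcongr
        linarith [Real.add_one_le_exp (4 * (ε : ℝ) ^ 2 / S)]
    _ = _ := by
        rw [← Real.exp_nat_mul]
        congr 1
        ring

end GapProblem

/-! ### Averaging over the hidden actions and choice of the gap. -/

section LowerBound

/-- Young's inequality followed by `x² ≤ x`. Keeping `x` to the first power lets the action
probabilities add up to 1 afterwards. -/
theorem ofReal_mul_le_add_sq {x t : ℝ} (hx0 : 0 ≤ x) (hx1 : x ≤ 1) (ht : 0 < t) (L : ℝ≥0∞) :
    ENNReal.ofReal x * L ≤
      ENNReal.ofReal (t / 2) * ENNReal.ofReal x + ENNReal.ofReal (1 / (2 * t)) * L ^ 2 := by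
  induction L with
  | top =>
    have : ENNReal.ofReal (1 / (2 * t)) ≠ 0 := by
      rw [Ne, ENNReal.ofReal_eq_zero, not_le]
      positivity
    rw [ENNReal.top_pow two_ne_zero, ENNReal.mul_top this, add_top]
    exact le_top
  | coe L =>
    obtain ⟨y, hy, hL⟩ : ∃ y : ℝ, 0 ≤ y ∧ (L : ℝ≥0∞) = ENNReal.ofReal y :=
      ⟨L, L.2, (ENNReal.ofReal_coe_nnreal).symm⟩
    rw [hL, ← ENNReal.ofReal_mul hx0, ← ENNReal.ofReal_pow hy, ← ENNReal.ofReal_mul (by positivity),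
      ← ENNReal.ofReal_mul (by positivity), ← ENNReal.ofReal_add (by positivity) (by positivity)]
    refine ENNReal.ofReal_le_ofReal ?_
    have h1 : t / 2 * x + 1 / (2 * t) * y ^ 2 - x * y =
        ((y - t * x) ^ 2 + t ^ 2 * (x * (1 - x))) / (2 * t) := by
      field_simp
      ring
    have h2 : 0 ≤ ((y - t * x) ^ 2 + t ^ 2 * (x * (1 - x))) / (2 * t) := by
      have := mul_nonneg hx0 (sub_nonneg.2 hx1)
      positivity
    linarith

/-- If every action has a likelihood ratio of second moment at most `K`, then the chances to
play the right action add up to at most `√(A K)`. -/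
theorem sum_lintegral_mul_le {A : ℕ} [NeZero A] {X : Type*} [MeasurableSpace X] (μ : Measure X)
    [IsProbabilityMeasure μ] (F : X → Fin A → ℝ) (hF0 : ∀ x a, 0 ≤ F x a)
    (hF1 : ∀ x, ∑ a, F x a = 1) (hF : ∀ a, Measurable fun x => F x a)
    (L : Fin A → X → ℝ≥0∞) (hL : ∀ a, Measurable (L a)) {K : ℝ} (hK : 0 < K)
    (hLK : ∀ a, ∫⁻ x, L a x ^ 2 ∂μ ≤ ENNReal.ofReal K) :
    ∑ a, ∫⁻ x, ENNReal.ofReal (F x a) * L a x ∂μ ≤ ENNReal.ofReal (√(A * K)) := by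
  have hA : (0 : ℝ) < A := by exact_mod_cast NeZero.pos A
  have hle : ∀ x a, F x a ≤ 1 := fun x a =>
    (Finset.single_le_sum (fun b _ => hF0 x b) (Finset.mem_univ a)).trans_eq (hF1 x)
  -- This `t` minimises the resulting bound `t/2 + A K/(2t)`.
  set t := √(A * K) with ht_def
  have ht : 0 < t := Real.sqrt_pos.2 (by positivity)
  have htt : t * t = A * K := Real.mul_self_sqrt (by positivity)
  have hFe : ∀ a, Measurable fun x => ENNReal.ofReal (F x a) := fun a => (hF a).ennreal_ofReal
  calc ∑ a, ∫⁻ x, ENNReal.ofReal (F x a) * L a x ∂μ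
      ≤ ∑ a, ∫⁻ x, ENNReal.ofReal (t / 2) * ENNReal.ofReal (F x a) +
          ENNReal.ofReal (1 / (2 * t)) * L a x ^ 2 ∂μ :=
        Finset.sum_le_sum fun a _ => lintegral_mono fun x =>
          ofReal_mul_le_add_sq (hF0 x a) (hle x a) ht _
    _ = ENNReal.ofReal (t / 2) * ∫⁻ x, ∑ a, ENNReal.ofReal (F x a) ∂μ +
          ENNReal.ofReal (1 / (2 * t)) * ∑ a, ∫⁻ x, L a x ^ 2 ∂μ := by
        rw [lintegral_finsetSum _ fun a _ => hFe a, Finset.mul_sum, Finset.mul_sum,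
          ← Finset.sum_add_distrib]
        refine Finset.sum_congr rfl fun a _ => ?_
        rw [lintegral_add_left ((hFe a).const_mul _), lintegral_const_mul _ (hFe a),
          lintegral_const_mul _ ((hL a).pow_const 2)]
    _ ≤ ENNReal.ofReal (t / 2) * 1 +
          ENNReal.ofReal (1 / (2 * t)) * ∑ _a : Fin A, ENNReal.ofReal K := by
        gcongr with a
        · refine le_of_eq ?_
          simp_rw [← ENNReal.ofReal_sum_of_nonneg fun a _ => hF0 _ a, hF1]
          simp
        · exact hLK a
    _ = ENNReal.ofReal t := by
        rw [← ENNReal.ofReal_sum_of_nonneg fun _ _ => hK.le, mul_one,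
          ← ENNReal.ofReal_mul (by positivity),
          ← ENNReal.ofReal_add (by positivity) (by positivity)]
        congr 1
        simp only [Finset.sum_const, Finset.card_univ, Fintype.card_fin, nsmul_eq_mul]
        rw [← htt]
        field_simp
        ring

/-- Resampling one coordinate does not change the sum over all functions. -/
theorem sum_sum_update {I B : Type*} [Fintype I] [DecidableEq I] [Fintype B] (i : I)
    (g : (I → B) → ℝ) :
    ∑ J : I → B, ∑ b, g (Function.update J i b) = Fintype.card B * ∑ J, g J := by
  rw [← Fintype.sum_prod_type' (f := fun J b => g (Function.update J i b))]
  -- Exchanging `J i` with the extra value `b` is a bijection of the pairs `(J, b)`; after it the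
  -- summand no longer involves `b`.
  have hinv : Function.Involutive fun x : (I → B) × B => (Function.update x.1 i x.2, x.1 i) := by
    rintro ⟨J, b⟩
    simp
  refine (Equiv.sum_comp hinv.toPerm (fun x : (I → B) × B => g x.1)).trans ?_
  rw [Fintype.sum_prod_type]
  simp [Finset.mul_sum]

variable {S A : ℕ} {Ω : Type*} [MeasurableSpace Ω]

/-- The action probabilities used in episode `n` and state `s`, as a function of the history. -/
def playProb (alg : Algorithm S A 1 Ω) {N : ℕ} (n : Fin N) (s : Fin S)
    (p : Ω × (Fin N → Episode S A 1)) : Fin A → ℝ :=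
  (alg.policy n (p.1, fun i : Fin n => p.2 (Fin.castLE n.isLt.le i)) 0 s : Fin A → ℝ)

theorem playProb_nonneg (alg : Algorithm S A 1 Ω) {N : ℕ} (n : Fin N) (s : Fin S)
    (p : Ω × (Fin N → Episode S A 1)) (a : Fin A) : 0 ≤ playProb alg n s p a :=
  stdSimplex.zero_le _ _

theorem sum_playProb (alg : Algorithm S A 1 Ω) {N : ℕ} (n : Fin N) (s : Fin S)
    (p : Ω × (Fin N → Episode S A 1)) : ∑ a, playProb alg n s p a = 1 :=
  stdSimplex.sum_eq_one _

theorem measurable_playProb (alg : Algorithm S A 1 Ω) {N : ℕ} (n : Fin N) (s : Fin S)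
    (a : Fin A) : Measurable fun p => playProb alg n s p a := by
  refine (measurable_policy_apply 0 s a).comp ((alg.measurable_policy n).comp ?_)
  refine measurable_fst.prodMk (measurable_pi_iff.2 fun i => ?_)
  exact (measurable_pi_apply _).comp measurable_snd

variable [NeZero S] [NeZero A] (ε : Set.Icc (0 : ℝ) (1 / 2))

/-- All `A` alternatives at `s₀` are transported to the same baseline law, where `F` sums to 1 over
the actions. -/
theorem sum_integral_update_le (J : Fin S → Option (Fin A)) (s₀ : Fin S) (hJ : J s₀ = none)
    (alg : Algorithm S A 1 Ω) (ν : ProbabilityMeasure Ω) (N : ℕ)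
    (F : Ω × (Fin N → Episode S A 1) → Fin A → ℝ) (hF0 : ∀ x a, 0 ≤ F x a)
    (hF1 : ∀ x, ∑ a, F x a = 1) (hF : ∀ a, Measurable fun x => F x a) :
    ∑ j, ∫ p, F p j ∂((gapProblem ε (Function.update J s₀ (some j))).historyLaw alg ν N) ≤
      √(A * Real.exp (4 * (ε : ℝ) ^ 2 * N / S)) := by
  have hle : ∀ x a, F x a ≤ 1 := fun x a =>
    (Finset.single_le_sum (fun b _ => hF0 x b) (Finset.mem_univ a)).trans_eq (hF1 x)
  have hprob := fun J => isProbabilityMeasure_historyLaw (gapProblem ε J) alg ν N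
  rw [← ENNReal.ofReal_le_ofReal_iff (Real.sqrt_nonneg _),
    ENNReal.ofReal_sum_of_nonneg fun j _ => integral_nonneg fun p => hF0 p j]
  refine le_trans (le_of_eq ?_) (sum_lintegral_mul_le ((gapProblem ε J).historyLaw alg ν N) F
    hF0 hF1 hF (fun j p => ∏ i, likelihood ε s₀ j (p.2 i 0).1 (p.2 i 0).2.2)
    (fun j => measurable_prod_likelihood (measurable_likelihood ε s₀ j) N) (Real.exp_pos _)
    fun j => lintegral_prod_likelihood_sq_le ε J s₀ hJ j alg ν N)
  refine Finset.sum_congr rfl fun j _ => ?_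
  rw [ofReal_integral_eq_lintegral_ofReal _ (ae_of_all _ fun p => hF0 p j)]
  · exact lintegral_historyLaw_eq_mul_prod
      (gapProblem ε (Function.update J s₀ (some j))) (gapProblem ε J) rfl
      (measurable_likelihood ε s₀ j) (oracle_gapProblem_update ε J s₀ hJ j) alg ν N
      (hF j).ennreal_ofReal
  · exact Integrable.of_bound (hF j).aestronglyMeasurable 1
      (ae_of_all _ fun p => by rw [Real.norm_of_nonneg (hF0 p j)]; exact hle p j)

/-- Sum over all `J` of the probabilities to play `J s₀` in state `s₀`. -/
theorem sum_integral_le (s₀ : Fin S) (alg : Algorithm S A 1 Ω) (ν : ProbabilityMeasure Ω) (N : ℕ)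
    (F : Ω × (Fin N → Episode S A 1) → Fin A → ℝ) (hF0 : ∀ x a, 0 ≤ F x a)
    (hF1 : ∀ x, ∑ a, F x a = 1) (hF : ∀ a, Measurable fun x => F x a) :
    ∑ J : Fin S → Fin A,
        ∫ p, F p (J s₀) ∂((gapProblem ε fun s => some (J s)).historyLaw alg ν N) ≤
      Fintype.card (Fin S → Fin A) * √(Real.exp (4 * (ε : ℝ) ^ 2 * N / S) / A) := by
  have hA : (0 : ℝ) < A := by exact_mod_cast NeZero.pos A
  have h := sum_sum_update s₀ fun J : Fin S → Fin A =>
    ∫ p, F p (J s₀) ∂((gapProblem ε fun s => some (J s)).historyLaw alg ν N)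
  have h2 : ∀ J : Fin S → Fin A, ∑ b, ∫ p, F p (Function.update J s₀ b s₀)
      ∂((gapProblem ε fun s => some (Function.update J s₀ b s)).historyLaw alg ν N) ≤
      √(A * Real.exp (4 * (ε : ℝ) ^ 2 * N / S)) := by
    intro J
    -- The baseline is `J` with its value at `s₀` erased; the other states keep their good actions.
    refine le_trans (le_of_eq ?_) (sum_integral_update_le ε
      (Function.update (fun s => some (J s)) s₀ none) s₀ (Function.update_self _ _ _)
      alg ν N F hF0 hF1 hF)
    refine Finset.sum_congr rfl fun b _ => ?_
    rw [Function.update_self, Function.update_idem]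
    congr 3
    ext1 s
    by_cases hs : s = s₀
    · subst hs; simp
    · simp [hs]
  have h3 := Finset.sum_le_sum fun J (_ : J ∈ Finset.univ) => h2 J
  rw [h, Finset.sum_const, Finset.card_univ, nsmul_eq_mul, Fintype.card_fin] at h3
  have h4 : √(A * Real.exp (4 * (ε : ℝ) ^ 2 * N / S)) =
      A * √(Real.exp (4 * (ε : ℝ) ^ 2 * N / S) / A) := by
    rw [← Real.sqrt_sq hA.le, ← Real.sqrt_mul (by positivity), Real.sqrt_sq hA.le]
    congr 1
    field_simp
  rw [h4, mul_left_comm] at h3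
  exact le_of_mul_le_mul_left h3 hA

/-- Every episode is integrated against the law of the full history, although its policy reads only
the past, so one second-moment bound serves all `n`. -/
theorem expectedRegret_gapProblem (J : Fin S → Fin A) (alg : Algorithm S A 1 Ω)
    (ν : ProbabilityMeasure Ω) (N : ℕ) :
    (gapProblem ε fun s => some (J s)).expectedRegret alg ν N =
      ∑ n : Fin N, (ε : ℝ) / S * ∑ s, (1 - ∫ p, playProb alg n s p (J s)
          ∂((gapProblem ε fun s => some (J s)).historyLaw alg ν N)) := by
  have hprob := isProbabilityMeasure_historyLaw (gapProblem ε fun s => some (J s)) alg ν N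
  have hint : ∀ (n : Fin N) (s : Fin S), Integrable (fun p => playProb alg n s p (J s))
      ((gapProblem ε fun s => some (J s)).historyLaw alg ν N) := by
    intro n s
    refine Integrable.of_bound (measurable_playProb alg n s (J s)).aestronglyMeasurable 1
      (ae_of_all _ fun p => ?_)
    rw [Real.norm_of_nonneg (playProb_nonneg alg n s p _), ← sum_playProb alg n s p]
    exact Finset.single_le_sum (fun b _ => playProb_nonneg alg n s p b) (Finset.mem_univ _)
  have hint' : ∀ (n : Fin N) (s : Fin S), Integrable (fun p => 1 - playProb alg n s p (J s))
      ((gapProblem ε fun s => some (J s)).historyLaw alg ν N) := fun n s =>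
    (integrable_const (1 : ℝ)).sub (hint n s)
  have hreg : ∀ p, (gapProblem ε fun s => some (J s)).regret alg N p =
      ∑ n : Fin N, (ε : ℝ) / S * ∑ s, (1 - playProb alg n s p (J s)) := fun p =>
    Finset.sum_congr rfl fun n _ => totalCost_sub_totalCost_expert_gapProblem ε J _
  rw [expectedRegret]
  simp_rw [hreg]
  rw [integral_finsetSum _ fun n _ => (integrable_finsetSum _ fun s _ => hint' n s).const_mul _]
  refine Finset.sum_congr rfl fun n _ => ?_
  rw [integral_const_mul, integral_finsetSum _ fun s _ => hint' n s]
  congr 1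
  refine Finset.sum_congr rfl fun s _ => ?_
  rw [integral_sub (integrable_const _) (hint n s)]
  simp

/-- Lower bound on the regret averaged over the position of the best actions. -/
theorem le_sum_expectedRegret_gapProblem (alg : Algorithm S A 1 Ω) (ν : ProbabilityMeasure Ω)
    (N : ℕ) :
    Fintype.card (Fin S → Fin A) *
        (N * (ε : ℝ) * (1 - √(Real.exp (4 * (ε : ℝ) ^ 2 * N / S) / A))) ≤
      ∑ J : Fin S → Fin A, (gapProblem ε fun s => some (J s)).expectedRegret alg ν N := by
  have hS : (0 : ℝ) < S := by exact_mod_cast NeZero.pos S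
  simp_rw [expectedRegret_gapProblem]
  rw [Finset.sum_comm]
  set C : ℝ := (Fintype.card (Fin S → Fin A) : ℝ)
  set r := √(Real.exp (4 * (ε : ℝ) ^ 2 * N / S) / A)
  calc C * (N * (ε : ℝ) * (1 - r)) = ∑ _n : Fin N, (ε : ℝ) / S * ∑ _s : Fin S, (C - C * r) := by
        simp only [Finset.sum_const, Finset.card_univ, Fintype.card_fin, nsmul_eq_mul]
        field_simp
    _ ≤ _ := by
        refine Finset.sum_le_sum fun n _ => ?_
        rw [← Finset.mul_sum]
        refine mul_le_mul_of_nonneg_left ?_ (div_nonneg ε.2.1 hS.le)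
        -- With episode and state fixed, the average over `J` is the innermost sum, as
        -- `sum_integral_le` requires.
        rw [Finset.sum_comm]
        refine Finset.sum_le_sum fun s _ => ?_
        rw [Finset.sum_sub_distrib]
        have := sum_integral_le ε s alg ν N (playProb alg n s) (playProb_nonneg alg n s)
          (sum_playProb alg n s) (measurable_playProb alg n s)
        rw [Finset.sum_const, Finset.card_univ, nsmul_eq_mul, mul_one]
        exact sub_le_sub_left this C

/-- The left side is `A^(-3/8)`, largest at `A = 2`, where it is about 0.77. -/
theorem sqrt_exp_quarter_log_div_le {A : ℕ} (hA : 2 ≤ A) :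
    √(Real.exp (1 / 4 * Real.log A) / A) ≤ 5 / 6 := by
  have hA' : (2 : ℝ) ≤ A := by exact_mod_cast hA
  have hlog : 0.69 ≤ Real.log A :=
    (by linarith [Real.log_two_gt_d9] : (0.69 : ℝ) ≤ Real.log 2).trans
      (Real.log_le_log two_pos hA')
  have h : Real.exp (1 / 4 * Real.log A) / A = (Real.exp (3 / 4 * Real.log A))⁻¹ := by
    rw [← Real.exp_neg]
    nth_rewrite 2 [← Real.exp_log (by linarith : (0 : ℝ) < A)]
    rw [← Real.exp_sub]
    congr 1
    ring
  rw [h]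
  refine Real.sqrt_le_iff.2 ⟨by norm_num, ?_⟩
  refine inv_le_of_inv_le₀ (by norm_num) ?_
  -- What remains is `(6/5)² = 1.44 ≤ 1 + (3/4) · 0.69`.
  refine le_trans ?_ (Real.add_one_le_exp _)
  norm_num
  linarith

/-- The gap `ε = √(S ln A / N) / 4` makes the averaged regret of order `√(S ln A N)`. -/
theorem exists_gap {S A N : ℕ} (hS : 0 < S) (hA : 0 < A) (hN : S * Real.log A ≤ N) :
    ∃ ε : Set.Icc (0 : ℝ) (1 / 2), 1 / 24 * √(S * Real.log A * N) ≤
      N * ε * (1 - √(Real.exp (4 * (ε : ℝ) ^ 2 * N / S) / A)) := by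
  have hS' : (0 : ℝ) < S := by exact_mod_cast hS
  obtain rfl | hA2 : A = 1 ∨ 2 ≤ A := by omega
  -- For one action `ln A = 0` and both sides vanish.
  · exact ⟨⟨0, by norm_num, by norm_num⟩, by simp⟩
  have hlog : 0 < Real.log A := Real.log_pos (by exact_mod_cast hA2)
  have hx : 0 < S * Real.log A := mul_pos hS' hlog
  have hN' : (0 : ℝ) < N := hx.trans_le hN
  -- This is where `N ≥ S ln A` enters: it gives `ε ≤ 1/4`, so the means stay in `[0, 1]`.
  have hle : √(S * Real.log A / N) ≤ 1 :=
    Real.sqrt_le_one.2 ((div_le_one hN').2 hN)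
  refine ⟨⟨√(S * Real.log A / N) / 4, by positivity, by linarith⟩, ?_⟩
  have hexp : 4 * (√(S * Real.log A / N) / 4) ^ 2 * N / S = 1 / 4 * Real.log A := by
    rw [div_pow, Real.sq_sqrt (by positivity)]
    field_simp
  have hsq : N * √(S * Real.log A / N) = √(S * Real.log A * N) := by
    rw [← Real.sqrt_sq hN'.le, ← Real.sqrt_mul (by positivity), Real.sqrt_sq hN'.le]
    congr 1
    field_simp
  simp only
  rw [hexp, ← hsq]
  have h56 := sqrt_exp_quarter_log_div_le hA2
  have h0 : 0 ≤ N * √(S * Real.log A / N) := by positivity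
  nlinarith

end LowerBound

end ImitationLearning

end

theorem theorem5 :
    ∃ c : ℝ, 0 < c ∧
      ∀ S A N : ℕ, 0 < S → 0 < A → (S : ℝ) * Real.log (A : ℝ) ≤ (N : ℝ) →
        ∃ (ι : Type) (_ : Fintype ι) (M : ι → ImitationLearning.Problem S A 1)
          (w : stdSimplex ℝ ι),
          (∀ i, (∀ s : Fin S, ((M i).init : Fin S → ℝ) s = 1 / (S : ℝ)) ∧ (M i).UnitBounded) ∧
          ∀ (Ω : Type*) [MeasurableSpace Ω] (alg : ImitationLearning.Algorithm S A 1 Ω)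
            (ν : MeasureTheory.ProbabilityMeasure Ω),
            c * Real.sqrt ((S : ℝ) * Real.log (A : ℝ) * (N : ℝ)) ≤
                ∑ i, (w : ι → ℝ) i * (M i).expectedRegret alg ν N ∧
            ∃ i, c * Real.sqrt ((S : ℝ) * Real.log (A : ℝ) * (N : ℝ)) ≤
                (M i).expectedRegret alg ν N := by
  refine ⟨1 / 24, by norm_num, fun S A N hS hA hN => ?_⟩
  have : NeZero S := ⟨hS.ne'⟩
  have : NeZero A := ⟨hA.ne'⟩
  obtain ⟨ε, hε⟩ := ImitationLearning.exists_gap hS hA hN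
  have hcard : (0 : ℝ) < Fintype.card (Fin S → Fin A) := by exact_mod_cast Fintype.card_pos
  refine ⟨Fin S → Fin A, inferInstance, fun J => ImitationLearning.gapProblem ε fun s => some (J s),
    ⟨fun _ => (Fintype.card (Fin S → Fin A) : ℝ)⁻¹, fun _ => by positivity, ?_⟩,
    fun J => ⟨fun s => rfl, ImitationLearning.unitBounded_bernoulliProblem _⟩, ?_⟩
  · rw [Finset.sum_const, Finset.card_univ, nsmul_eq_mul, mul_inv_cancel₀ hcard.ne']
  intro Ω _ alg ν
  have hsum := (mul_le_mul_of_nonneg_left hε hcard.le).trans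
    (ImitationLearning.le_sum_expectedRegret_gapProblem ε alg ν N)
  constructor
  · change _ ≤ ∑ J : Fin S → Fin A, (Fintype.card (Fin S → Fin A) : ℝ)⁻¹ * _
    rw [← Finset.mul_sum, le_inv_mul_iff₀ hcard]
    exact hsum
  -- Some member of the family is at least as bad as the uniform average.
  · obtain ⟨J, -, hJ⟩ := Finset.exists_le_of_sum_le (s := Finset.univ)
      (f := fun _ : Fin S → Fin A => 1 / 24 * √(S * Real.log A * N)) Finset.univ_nonempty
      (by simpa only [Finset.sum_const, Finset.card_univ, nsmul_eq_mul] using hsum)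
    exact ⟨J, hJ⟩
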